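/- **Setting.** Let $N,d,T\ge 0$ and $m\ge 1$ be integers, and consider input sequences $u=(u[t])_{t\ge 0}$ in $\mathbb R^d$. A selective SSM with parameters $A_c=\mathrm{diag}(A^{(1)},\dots,A^{(d)})$ ($A^{(j)}\in\mathbb R^{N\times N}$), $W_B,W_C\in\mathbb R^{N\times d}$, $p\in\mathbb R$, $q,w\in\mathbb R^d$ has the scalar output $z=w^\top y[T]$, where $x[0]=0$, $$x[t+1]=e^{\Delta[t]A_c}x[t]+\Delta[t]\,(I_d\otimes W_Bu[t])\,u[t],\qquad y[t]=(I_d\otimes u[t]^\top W_C^\top)\,x[t],\qquad \Delta[t]=\ln\bigl(1+e^{p+q^\top u[t]}\bigr).$$ **Reduction.** If $A_c=0$, $q=0$ and $p=\ln(e-1)$, then $\Delta[t]=1$ for all $t$ and the output is that of causal linear attention, $$z=w^\top\sum_{t=0}^{T-1}(I_d\otimes u[T]^\top W_C^\top)\,(I_d\otimes W_Bu[T-1-t])\,u[T-1-t].$$ **Bound.** Let $\mathcal F_{LA}$ be the class of all these maps $h:u\mapsto z$ with $\|W_B\|_2\le B_B$, $\|W_B\|_{1,1}\le M_B$, $\|W_C\|_2\le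 B_C$, $\|W_C\|_{1,1}\le M_C$, $\|w\|_2\le B_w$, $\|w\|_1\le M_w$, where $M_B=B_B$, $M_C=B_C$, $M_w=B_w$. Here $\|W\|_2$ is the spectral norm of a matrix $W$ and $\|W\|_{1,1}=\sum_{i,j}|W_{ij}|$. Let $(u,z)$ be a random pair of an input sequence and a label $z\in\mathbb R$ such that almost surely $\|u[t]\|_2\le B_u$ for all $t$, and let $S=\{(u_{(i)},z_{(i)})\}_{i=1}^m$ be i.i.d. copies of it. Let the loss $l:\mathbb R\times\mathbb R\to\mathbb R$ be measurable, with $|l|\le c_l$, and Lipschitz in its first argument with constant $\ell_l$. Then there are universal constants $K>0$ and $k\in\mathbb N$ (depending on none of the quantities above) such that, with $$C_{LA}=K\,(1+\ln(Nd))^{k}\;T\,B_w\,B_B\,B_C\,B_u^3$$ (the factor $(1+\ln(Nd))^k$ being read as $1$ if $Nd=0$), for every $\delta\in(0,1)$, with probability at least $1-\delta$ over $S$, simultaneously for all $h\in\mathcal F_{LA}$, $$\Bigl|\mathbb E_{u,z}\,l(h(u),z)-\frac1m\sum_{i=1}^m l(h(u_{(i)}),z_{(i)})\Bigr|\le\frac{12\,\ell_l\,C_{LA}}{\sqrt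 m}\Bigl(1+\ln^{+}\!\Bigl(\frac{c_l\sqrt m}{3\,C_{LA}}\Bigr)\Bigr)+3c_l\sqrt{\frac{\ln(2/\delta)}{2m}},$$ where $\ln^{+}=\max(0,\ln)$, and the first term on the right is $0$ if $C_{LA}=0$. For $3C_{LA}\le c_l\sqrt m$ the positive part can be dropped. -/

import Mathlib

open MeasureTheory
open scoped Kronecker Matrix

noncomputable section

namespace SSM

/-- Discrete-time input signals with `d` channels; `u t` is the token `u[t]`, carrying the
Euclidean norm. The output at time `T` only reads `u[0], …, u[T]`. -/
abbrev Signal (d : ℕ) : Type := ℕ → EuclideanSpace ℝ (Fin d)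

/-- The softplus function `τ(x) = ln (1 + e ^ x)`. -/
def softplus (x : ℝ) : ℝ := Real.log (1 + Real.exp x)

/-- The block diagonal matrix `A_c = diag(A⁽¹⁾, …, A⁽ᵈ⁾)`, of size `dN × dN`. -/
def stateMatrix {N d : ℕ} (A : Fin d → Matrix (Fin N) (Fin N) ℝ) :
    Matrix (Fin d × Fin N) (Fin d × Fin N) ℝ :=
  (Matrix.blockDiagonal A).submatrix Prod.swap Prod.swap

/-- The matrix `I_d ⊗ (W_B v)`, of size `dN × d`. -/
def inputMatrix {N d : ℕ} (WB : Matrix (Fin N) (Fin d) ℝ) (v : EuclideanSpace ℝ (Fin d)) :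
    Matrix (Fin d × Fin N) (Fin d) ℝ :=
  ((1 : Matrix (Fin d) (Fin d) ℝ) ⊗ₖ Matrix.replicateCol Unit (WB *ᵥ v.ofLp)).submatrix
    id (fun j => (j, ()))

/-- The matrix `I_d ⊗ (vᵀ W_Cᵀ)`, of size `d × dN`. -/
def outputMatrix {N d : ℕ} (WC : Matrix (Fin N) (Fin d) ℝ) (v : EuclideanSpace ℝ (Fin d)) :
    Matrix (Fin d) (Fin d × Fin N) ℝ :=
  ((1 : Matrix (Fin d) (Fin d) ℝ) ⊗ₖ Matrix.replicateRow Unit (v.ofLp ᵥ* WCᵀ)).submatrix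
    (fun i => (i, ())) id

/-- The input-dependent step size `Δ[t] = τ(p + qᵀ u[t])`. -/
def stepSize {d : ℕ} (p : ℝ) (q : EuclideanSpace ℝ (Fin d)) (u : Signal d) (t : ℕ) : ℝ :=
  softplus (p + q.ofLp ⬝ᵥ (u t).ofLp)

/-- The state of the selective SSM: `x[0] = 0` and
`x[t+1] = exp(Δ[t] A_c) x[t] + Δ[t] (I_d ⊗ W_B u[t]) u[t]`. -/
def state {N d : ℕ} (A : Fin d → Matrix (Fin N) (Fin N) ℝ) (WB : Matrix (Fin N) (Fin d) ℝ)
    (p : ℝ) (q : EuclideanSpace ℝ (Fin d)) (u : Signal d) : ℕ → (Fin d × Fin N → ℝ)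
  | 0 => 0
  | t + 1 =>
      NormedSpace.exp (stepSize p q u t • stateMatrix A) *ᵥ state A WB p q u t
        + stepSize p q u t • (inputMatrix WB (u t) *ᵥ (u t).ofLp)

/-- The scalar output `z = wᵀ y[T]` of the selective SSM, where
`y[T] = (I_d ⊗ u[T]ᵀ W_Cᵀ) x[T]`. -/
def selectiveSSM {N d : ℕ} (A : Fin d → Matrix (Fin N) (Fin N) ℝ)
    (WB WC : Matrix (Fin N) (Fin d) ℝ) (p : ℝ) (q w : EuclideanSpace ℝ (Fin d)) (T : ℕ)
    (u : Signal d) : ℝ :=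
  w.ofLp ⬝ᵥ (outputMatrix WC (u T) *ᵥ state A WB p q u T)

/-- Causal linear attention,
`z = wᵀ ∑_{t=0}^{T-1} (I_d ⊗ u[T]ᵀ W_Cᵀ) (I_d ⊗ W_B u[T-1-t]) u[T-1-t]`. -/
def linearAttention {N d : ℕ} (WB WC : Matrix (Fin N) (Fin d) ℝ)
    (w : EuclideanSpace ℝ (Fin d)) (T : ℕ) (u : Signal d) : ℝ :=
  w.ofLp ⬝ᵥ ∑ t ∈ Finset.range T,
    outputMatrix WC (u T) *ᵥ (inputMatrix WB (u (T - 1 - t)) *ᵥ (u (T - 1 - t)).ofLp)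

/-- The spectral norm `‖W‖₂`, i.e. the operator norm between Euclidean spaces. -/
def spectralNorm {N d : ℕ} (W : Matrix (Fin N) (Fin d) ℝ) : ℝ :=
  ‖LinearMap.toContinuousLinearMap (Matrix.toEuclideanLin W)‖

/-- The mixed norm `‖W‖_{1,1}`: the `ℓ¹` norm of the vector of `ℓ¹` norms of the columns. -/
def norm11 {N d : ℕ} (W : Matrix (Fin N) (Fin d) ℝ) : ℝ := ∑ j, ∑ i, |W i j|

/-- The class of linear attentions with parameters `W_B, W_C, w` obeying
`‖W_B‖₂ ≤ B_B`, `‖W_B‖_{1,1} ≤ M_B`, `‖W_C‖₂ ≤ B_C`, `‖W_C‖_{1,1} ≤ M_C`, `‖w‖₂ ≤ B_w`,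
`‖w‖₁ ≤ M_w`. -/
def linearAttentionClass (N d T : ℕ) (B_B M_B B_C M_C B_w M_w : ℝ) : Set (Signal d → ℝ) :=
  {h | ∃ (WB WC : Matrix (Fin N) (Fin d) ℝ) (w : EuclideanSpace ℝ (Fin d)),
    spectralNorm WB ≤ B_B ∧ norm11 WB ≤ M_B ∧
    spectralNorm WC ≤ B_C ∧ norm11 WC ≤ M_C ∧
    ‖w‖ ≤ B_w ∧ ∑ j, |w j| ≤ M_w ∧
    h = linearAttention WB WC w T}

/-- The generalization gap `|E l(h(u), z) - (1/m) ∑ᵢ l(h(u₍ᵢ₎), z₍ᵢ₎)|` of the predictor `h`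
for the data law `μ` and the training set `S`. -/
def generalizationGap {d m : ℕ} (loss : ℝ → ℝ → ℝ) (μ : Measure (Signal d × ℝ))
    (S : Fin m → Signal d × ℝ) (h : Signal d → ℝ) : ℝ :=
  |∫ x, loss (h x.1) x.2 ∂μ - (1 / (m : ℝ)) * ∑ i, loss (h (S i).1) (S i).2|

/-- The bound
`(12 ℓ C / √m) (1 + ln⁺(c √m / (3 C))) + 3 c √(ln(2/δ) / (2m))`, where `ln⁺ = max 0 ln`.
The positive part is inactive when `3 C ≤ c √m`; without it the expression may be negative
for small `m`. -/
def gapBound (m : ℕ) (ℓ c δ C : ℝ) : ℝ :=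
  12 * ℓ * C / √m * (1 + max 0 (Real.log (c * √m / (3 * C))))
    + 3 * c * √(Real.log (2 / δ) / (2 * m))

end SSM

end

/-!
Linear attention is linear in a fixed feature of the input: with
`φ(u) = ∑_{s<T} u[s] ⊗ u[T] ⊗ u[s]` and `θ = w ⊗ W_Cᵀ W_B` one has `h(u) = ⟪θ, φ(u)⟫`
(`linearAttention_eq_inner`). The norm of `θ` is at most its `ℓ¹` norm, hence at most
`‖w‖₁ ‖W_C‖_{1,1} ‖W_B‖_{1,1} ≤ B_w B_C B_B` (`norm_attentionTensor_le`), and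
`‖φ(u)‖ ≤ T B_u³` (`norm_attentionFeature_le`). So the claim follows from the
dimension-free generalization bound for the linear predictors with `‖θ‖ ≤ R` on features of norm
at most `r` (`le_measure_forall_linear_predictor`), in which no logarithm of the dimensions
appears: the capacity holds with `K = 1` and `k = 0`.

The bound for linear predictors is the Rademacher complexity argument. For a finite subfamily, the
largest deviation `sup_θ (E g_θ - (1/m) ∑ᵢ g_θ(xᵢ))` concentrates around its mean by the bounded
differences inequality (`measure_add_integral_le_of_boundedDiff`, Hoeffding's lemma applied to one
coordinate at a time). The mean is at most twice the Rademacher complexity of the composed class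
(`integral_ciSup_deviation_le`, exchanging each sample point with an independent copy). The
Lipschitz loss is removed by the contraction principle (`sum_signs_ciSup_le_of_contraction`), and
Cauchy–Schwarz with the iterated parallelogram law (`sum_signs_norm_sq`) gives `ℓ R r / √m` for
what remains. Applying this to `g` and `-g` with `δ / 2` each yields the two-sided bound. It passes
to the whole ball of parameters through a countable dense subset
(`le_measure_forall_mem_closedBall`), which also disposes of the measurability of the supremum.
-/

namespace SSM

/-! ### Averages over random signs -/

/-- The sign `±1` encoded by a Boolean, so that `Fin n → Bool` is the finite probability space of
`n` Rademacher signs (up to the factor `2 ^ n`). -/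
def boolSign (b : Bool) : ℝ := if b then 1 else -1

@[simp] lemma boolSign_true : boolSign true = 1 := rfl

@[simp] lemma boolSign_false : boolSign false = -1 := rfl

lemma sum_signs_succ {M : Type*} [AddCommMonoid M] (n : ℕ) (F : (Fin (n + 1) → Bool) → M) :
    ∑ e, F e = ∑ e : Fin n → Bool,
      (F (Fin.cons true e) + F (Fin.cons false e)) := by
  rw [← (Fin.consEquiv fun _ : Fin (n + 1) => Bool).sum_comp F, Fintype.sum_prod_type_right]
  simp [Fin.consEquiv]

/-- One coordinate of the contraction principle: of two maximizers of the left-hand side, one can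
be charged to either sign on the right-hand side. -/
lemma ciSup_add_add_ciSup_sub_le {ι : Type*} [Finite ι] [Nonempty ι] (v a b : ι → ℝ)
    (hab : ∀ k l, |a k - a l| ≤ |b k - b l|) :
    (⨆ k, (v k + a k)) + (⨆ k, (v k - a k)) ≤ (⨆ k, (v k + b k)) + ⨆ k, (v k - b k) := by
  obtain ⟨k, hk⟩ := exists_eq_ciSup_of_finite (f := fun k => v k + a k)
  obtain ⟨l, hl⟩ := exists_eq_ciSup_of_finite (f := fun k => v k - a k)
  have hp : ∀ i, v i + b i ≤ ⨆ k, (v k + b k) := le_ciSup (Set.finite_range _).bddAbove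
  have hm : ∀ i, v i - b i ≤ ⨆ k, (v k - b k) := le_ciSup (Set.finite_range _).bddAbove
  rw [← hk, ← hl]
  have h1 := (le_abs_self _).trans (hab k l)
  rcases abs_cases (b k - b l) with h | h <;>
    linarith [hp k, hp l, hm k, hm l]

/-- The contraction principle for Rademacher averages over a finite index set, with an arbitrary
offset `v` so that the induction on the number of signs goes through. -/
lemma sum_signs_ciSup_le_of_contraction {ι : Type*} [Finite ι] [Nonempty ι] (n : ℕ)
    (v : ι → ℝ) (a b : ι → Fin n → ℝ) (hab : ∀ i k l, |a k i - a l i| ≤ |b k i - b l i|) :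
    ∑ e : Fin n → Bool, (⨆ k, (v k + ∑ i, boolSign (e i) * a k i)) ≤
      ∑ e : Fin n → Bool, ⨆ k, (v k + ∑ i, boolSign (e i) * b k i) := by
  induction n generalizing v with
  | zero => simp
  | succ n ih =>
    have key (w : ι → ℝ) := ih w (fun k i => a k i.succ) (fun k i => b k i.succ)
      fun i => hab i.succ
    simp only [sum_signs_succ, Fin.sum_univ_succ, Fin.cons_zero, Fin.cons_succ, boolSign_true,
      boolSign_false, one_mul, neg_mul, ← add_assoc, ← sub_eq_add_neg]
    calc _ ≤ ∑ e : Fin n → Bool, ((⨆ k, (v k + a k 0 + ∑ i, boolSign (e i) * b k i.succ)) +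
          ⨆ k, (v k - a k 0 + ∑ i, boolSign (e i) * b k i.succ)) := by
          rw [Finset.sum_add_distrib, Finset.sum_add_distrib]
          exact add_le_add (key fun k => v k + a k 0) (key fun k => v k - a k 0)
      _ ≤ _ := by
          refine Finset.sum_le_sum fun e _ => ?_
          simpa only [add_right_comm, sub_add_eq_add_sub] using ciSup_add_add_ciSup_sub_le
            (fun k => v k + ∑ i, boolSign (e i) * b k i.succ) (fun k => a k 0) (fun k => b k 0)
            (hab 0)

/-- Iterated parallelogram law. -/
lemma sum_signs_norm_sq {H : Type*} [NormedAddCommGroup H] [InnerProductSpace ℝ H] (n : ℕ)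
    (x : H) (v : Fin n → H) :
    ∑ e : Fin n → Bool, ‖x + ∑ i, boolSign (e i) • v i‖ ^ 2 =
      2 ^ n * (‖x‖ ^ 2 + ∑ i, ‖v i‖ ^ 2) := by
  induction n generalizing x with
  | zero => simp
  | succ n ih =>
    simp only [sum_signs_succ, Fin.sum_univ_succ, Fin.cons_zero, Fin.cons_succ, boolSign_true,
      boolSign_false, one_smul, neg_smul, ← add_assoc, ← sub_eq_add_neg]
    rw [Finset.sum_add_distrib, ih (x + v 0) (fun i => v i.succ),
      ih (x - v 0) (fun i => v i.succ)]
    have := parallelogram_law_with_norm ℝ x (v 0)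
    linear_combination (2 : ℝ) ^ n * this

lemma sum_signs_norm_le {H : Type*} [NormedAddCommGroup H] [InnerProductSpace ℝ H] (n : ℕ)
    (v : Fin n → H) {r : ℝ} (hr : 0 ≤ r) (hv : ∀ i, ‖v i‖ ≤ r) :
    ∑ e : Fin n → Bool, ‖∑ i, boolSign (e i) • v i‖ ≤ 2 ^ n * (r * √n) := by
  have h1 := sum_signs_norm_sq n 0 v
  simp only [zero_add, norm_zero, ne_eq, OfNat.ofNat_ne_zero, not_false_eq_true, zero_pow] at h1
  have h2 : ∑ i, ‖v i‖ ^ 2 ≤ n * r ^ 2 := by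
    calc _ ≤ ∑ _i : Fin n, r ^ 2 :=
          Finset.sum_le_sum fun i _ => pow_le_pow_left₀ (norm_nonneg _) (hv i) 2
      _ = _ := by simp
  have h3 := sq_sum_le_card_mul_sum_sq (s := (Finset.univ : Finset (Fin n → Bool)))
    (f := fun e => ‖∑ i, boolSign (e i) • v i‖)
  rw [h1] at h3
  simp only [Finset.card_univ, Fintype.card_pi, Fintype.card_bool, Finset.prod_const,
    Fintype.card_fin, Nat.cast_pow, Nat.cast_ofNat] at h3
  refine abs_le_of_sq_le_sq' (h3.trans ?_) (by positivity) |>.2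
  calc _ ≤ (2 : ℝ) ^ n * (2 ^ n * (n * r ^ 2)) := by gcongr
    _ = _ := by rw [mul_pow, mul_pow, Real.sq_sqrt (Nat.cast_nonneg n)]; ring

/-- The Rademacher complexity of the linear predictors `⟪θ, ·⟫` with `‖θ‖ ≤ R`, after
composition with maps that contract up to the factor `ℓ`. -/
lemma sum_signs_ciSup_le_of_linear {H ι : Type*} [NormedAddCommGroup H] [InnerProductSpace ℝ H]
    [Finite ι] [Nonempty ι] (n : ℕ) (θ : ι → H) (φ : Fin n → H) (a : ι → Fin n → ℝ)
    {ℓ R r : ℝ} (hℓ : 0 ≤ ℓ) (hR : 0 ≤ R) (hr : 0 ≤ r) (hθ : ∀ k, ‖θ k‖ ≤ R)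
    (hφ : ∀ i, ‖φ i‖ ≤ r)
    (ha : ∀ i k l, |a k i - a l i| ≤ ℓ * |inner ℝ (θ k) (φ i) - inner ℝ (θ l) (φ i)|) :
    ∑ e : Fin n → Bool, (⨆ k, ∑ i, boolSign (e i) * a k i) ≤
      2 ^ n * (ℓ * R * r * √n) := by
  have h := sum_signs_ciSup_le_of_contraction n (fun _ : ι => 0) a
    (fun k i => ℓ * inner ℝ (θ k) (φ i)) (by
      intro i k l
      rw [← mul_sub, abs_mul, abs_of_nonneg hℓ]
      exact ha i k l)
  simp only [zero_add] at h
  calc _ ≤ _ := h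
    _ ≤ ∑ e : Fin n → Bool, ℓ * R * ‖∑ i, boolSign (e i) • φ i‖ := by
        refine Finset.sum_le_sum fun e _ => ciSup_le fun k => ?_
        have : ∑ i, boolSign (e i) * (ℓ * inner ℝ (θ k) (φ i)) =
            ℓ * inner ℝ (θ k) (∑ i, boolSign (e i) • φ i) := by
          simp only [inner_sum, inner_smul_right, Finset.mul_sum]
          exact Finset.sum_congr rfl fun i _ => by ring
        rw [this, mul_assoc]
        gcongr
        exact (real_inner_le_norm _ _).trans (by gcongr; exact hθ k)
    _ ≤ ℓ * R * (2 ^ n * (r * √n)) := by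
        rw [← Finset.mul_sum]
        gcongr
        exact sum_signs_norm_le n φ hr hφ
    _ = _ := by ring

/-! ### The bounded differences inequality -/

open ProbabilityTheory in
/-- Hoeffding's lemma for a function of oscillation at most `b`. -/
lemma integral_exp_mul_le_of_oscillation {X : Type*} [MeasurableSpace X] (μ : Measure X)
    [IsProbabilityMeasure μ] {f : X → ℝ} (hf : Measurable f) {b : ℝ}
    (hb : ∀ x y, |f x - f y| ≤ b) (s : ℝ) :
    ∫ x, Real.exp (s * f x) ∂μ ≤ Real.exp (s * ∫ x, f x ∂μ + b ^ 2 / 8 * s ^ 2) := by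
  have : Nonempty X := nonempty_of_isProbabilityMeasure μ
  let x₀ : X := Classical.arbitrary X
  have hbdd : BddBelow (Set.range f) :=
    ⟨f x₀ - b, by rintro _ ⟨x, rfl⟩; linarith [(abs_le.1 (hb x x₀)).1]⟩
  have hmem : ∀ x, f x ∈ Set.Icc (⨅ y, f y) ((⨅ y, f y) + b) := fun x =>
    ⟨ciInf_le hbdd x, by
      have : f x - b ≤ ⨅ y, f y := le_ciInf fun y => by linarith [(abs_le.1 (hb x y)).2]
      linarith⟩
  have h := (hasSubgaussianMGF_of_mem_Icc hf.aemeasurable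
    (Filter.Eventually.of_forall hmem : ∀ᵐ x ∂μ, _)).mgf_le s
  simp only [mgf, add_sub_cancel_left, NNReal.coe_pow, NNReal.coe_div, coe_nnnorm,
    Real.norm_eq_abs, NNReal.coe_ofNat, div_pow, sq_abs, mul_sub, Real.exp_sub] at h
  rw [integral_div, div_le_iff₀ (Real.exp_pos _), ← Real.exp_add] at h
  refine h.trans_eq ?_
  congr 1
  ring

/-- The moment generating function bound behind the bounded differences inequality, by
integrating out one coordinate at a time. -/
lemma integral_exp_mul_le_of_boundedDiff {X : Type*} [MeasurableSpace X] (μ : Measure X)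
    [IsProbabilityMeasure μ] {b : ℝ} (s : ℝ) (n : ℕ) (f : (Fin n → X) → ℝ) (hf : Measurable f)
    {C : ℝ} (hC : ∀ S, |f S| ≤ C) (hb : ∀ S i x, |f (Function.update S i x) - f S| ≤ b) :
    ∫ S, Real.exp (s * f S) ∂(Measure.pi fun _ : Fin n => μ) ≤
      Real.exp (s * ∫ S, f S ∂(Measure.pi fun _ : Fin n => μ) + n * (b ^ 2 / 8) * s ^ 2) := by
  induction n with
  | zero =>
    have hS : ∀ S, f S = f default := fun S => congrArg f (Subsingleton.elim _ _)
    simp [hS]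
  | succ n ih =>
    set P := Measure.pi fun _ : Fin n => μ
    have hmp := (measurePreserving_piFinSuccAbove (fun _ : Fin (n + 1) => μ) 0).symm
    have hcons : Measurable fun p : X × (Fin n → X) => (Fin.cons p.1 p.2 : Fin (n + 1) → X) := by
      have := hmp.measurable
      simpa [MeasurableEquiv.piFinSuccAbove, Fin.insertNthEquiv] using this
    have hchange (F : (Fin (n + 1) → X) → ℝ) :
        ∫ S, F S ∂(Measure.pi fun _ : Fin (n + 1) => μ) =
          ∫ p, F (Fin.cons p.1 p.2) ∂(μ.prod P) := by
      rw [← hmp.integral_comp' F]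
      simp [MeasurableEquiv.piFinSuccAbove, Fin.insertNthEquiv, P]
    have hint : Integrable (fun p : X × (Fin n → X) => f (Fin.cons p.1 p.2)) (μ.prod P) :=
      Integrable.of_bound (hf.comp hcons).aestronglyMeasurable C
        (Filter.Eventually.of_forall fun p => hC _)
    have hexp : Integrable
        (fun p : X × (Fin n → X) => Real.exp (s * f (Fin.cons p.1 p.2))) (μ.prod P) :=
      Integrable.of_bound
        (Real.measurable_exp.comp ((hf.comp hcons).const_mul s)).aestronglyMeasurable
        (Real.exp (|s| * C)) (Filter.Eventually.of_forall fun p => by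
          rw [Real.norm_eq_abs, Real.abs_exp]
          refine Real.exp_le_exp.2 ((le_abs_self _).trans ?_)
          rw [abs_mul]
          exact mul_le_mul_of_nonneg_left (hC _) (abs_nonneg s))
    have hsec (S : Fin n → X) : Measurable fun x => f (Fin.cons x S) :=
      (hf.comp hcons).comp (measurable_id.prodMk measurable_const)
    have hsecint (S : Fin n → X) : Integrable (fun x => f (Fin.cons x S)) μ :=
      Integrable.of_bound (hsec S).aestronglyMeasurable C
        (Filter.Eventually.of_forall fun p => hC _)
    set g : (Fin n → X) → ℝ := fun S => ∫ x, f (Fin.cons x S) ∂μ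
    have hg : Measurable g :=
      (StronglyMeasurable.integral_prod_left' (f := fun p : X × (Fin n → X) =>
        f (Fin.cons p.1 p.2)) (hf.comp hcons).stronglyMeasurable).measurable
    have hgC : ∀ S, |g S| ≤ C := fun S => by
      have := norm_integral_le_of_norm_le_const (μ := μ) (f := fun x => f (Fin.cons x S)) (C := C)
        (Filter.Eventually.of_forall fun x => hC _)
      simpa using this
    have hgb : ∀ S i x, |g (Function.update S i x) - g S| ≤ b := fun S i x => by
      simp only [g]
      rw [← integral_sub (hsecint _) (hsecint _)]
      have := norm_integral_le_of_norm_le_const (μ := μ)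
        (f := fun y => f (Fin.cons y (Function.update S i x)) - f (Fin.cons y S)) (C := b)
        (Filter.Eventually.of_forall fun y => by
          rw [Fin.cons_update]; exact hb _ _ _)
      simpa using this
    have hgexp : Integrable (fun S => Real.exp (s * g S)) P :=
      Integrable.of_bound (Real.measurable_exp.comp (hg.const_mul s)).aestronglyMeasurable
        (Real.exp (|s| * C)) (Filter.Eventually.of_forall fun p => by
          rw [Real.norm_eq_abs, Real.abs_exp]
          refine Real.exp_le_exp.2 ((le_abs_self _).trans ?_)
          rw [abs_mul]
          exact mul_le_mul_of_nonneg_left (hgC _) (abs_nonneg s))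
    rw [hchange, hchange, integral_prod_symm _ hexp, integral_prod_symm _ hint]
    calc _ ≤ ∫ S, Real.exp (s * g S) * Real.exp (b ^ 2 / 8 * s ^ 2) ∂P := by
          refine integral_mono hexp.integral_prod_right (hgexp.mul_const _) fun S => ?_
          rw [← Real.exp_add]
          refine integral_exp_mul_le_of_oscillation μ (hsec S) (fun x y => ?_) s
          have := hb (Fin.cons y S) 0 x
          rwa [Fin.update_cons_zero] at this
      _ ≤ Real.exp (s * ∫ S, g S ∂P + n * (b ^ 2 / 8) * s ^ 2) * Real.exp (b ^ 2 / 8 * s ^ 2) := by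
          rw [integral_mul_const]
          gcongr
          exact ih g hg hgC hgb
      _ = _ := by
          rw [← Real.exp_add]
          congr 1
          push_cast
          ring

open ProbabilityTheory in
/-- The bounded differences (McDiarmid) inequality, one-sided. -/
lemma measure_add_integral_le_of_boundedDiff {X : Type*} [MeasurableSpace X] (μ : Measure X)
    [IsProbabilityMeasure μ] {b : ℝ} (n : ℕ) (f : (Fin n → X) → ℝ) (hf : Measurable f)
    {C : ℝ} (hC : ∀ S, |f S| ≤ C) (hb : ∀ S i x, |f (Function.update S i x) - f S| ≤ b)
    {ε : ℝ} (hε : 0 ≤ ε) :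
    (Measure.pi fun _ : Fin n => μ).real
        {S | ∫ S', f S' ∂(Measure.pi fun _ : Fin n => μ) + ε ≤ f S} ≤
      Real.exp (-2 * ε ^ 2 / (n * b ^ 2)) := by
  set P := Measure.pi fun _ : Fin n => μ
  have hvar : ((n * b ^ 2 / 4).toNNReal : ℝ) = n * b ^ 2 / 4 :=
    Real.coe_toNNReal _ (by positivity)
  have hsub : HasSubgaussianMGF (fun S => f S - ∫ S', f S' ∂P)
      (n * b ^ 2 / 4).toNNReal P := by
    refine ⟨fun t => ?_, fun t => ?_⟩
    · refine Integrable.of_bound (C := Real.exp (|t| * (C + |∫ S', f S' ∂P|)))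
        (Real.measurable_exp.comp ((hf.sub_const _).const_mul t)).aestronglyMeasurable
        (Filter.Eventually.of_forall fun S => ?_)
      rw [Real.norm_eq_abs, Real.abs_exp]
      refine Real.exp_le_exp.2 ((le_abs_self _).trans ?_)
      rw [abs_mul]
      refine mul_le_mul_of_nonneg_left ((abs_sub _ _).trans ?_) (abs_nonneg t)
      linarith [hC S]
    · have h := integral_exp_mul_le_of_boundedDiff μ t n f hf hC hb
      simp only [mgf, mul_sub, Real.exp_sub, hvar]
      rw [integral_div, div_le_iff₀ (Real.exp_pos _), ← Real.exp_add]
      refine h.trans_eq ?_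
      congr 1
      ring
  have h := hsub.measure_ge_le hε
  rw [hvar, show (2 : ℝ) * (n * b ^ 2 / 4) = (n * b ^ 2) / 2 by ring, div_div_eq_mul_div,
    show -ε ^ 2 * 2 = -2 * ε ^ 2 by ring] at h
  simpa only [le_sub_iff_add_le'] using h

/-! ### Symmetrization -/

lemma abs_ciSup_le {ι : Type*} [Finite ι] [Nonempty ι] {x : ι → ℝ} {C : ℝ}
    (h : ∀ k, |x k| ≤ C) : |⨆ k, x k| ≤ C := by
  obtain ⟨k, hk⟩ := exists_eq_ciSup_of_finite (f := x)
  rw [← hk]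
  exact h k

lemma abs_sum_fin_le {n : ℕ} {x : Fin n → ℝ} {C : ℝ} (h : ∀ i, |x i| ≤ C) :
    |∑ i, x i| ≤ n * C := by
  refine (Finset.abs_sum_le_sum_abs _ _).trans ((Finset.sum_le_sum fun i _ => h i).trans ?_)
  simp

lemma ciSup_add_le_ciSup_add_ciSup {ι : Type*} [Finite ι] [Nonempty ι] (x y : ι → ℝ) :
    ⨆ k, (x k + y k) ≤ (⨆ k, x k) + ⨆ k, y k :=
  ciSup_le fun k => add_le_add (le_ciSup (Set.finite_range x).bddAbove k)
    (le_ciSup (Set.finite_range y).bddAbove k)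

lemma boolSign_not (b : Bool) : boolSign (!b) = -boolSign b := by cases b <;> simp

/-- The uniform distribution on signs is symmetric. -/
lemma sum_signs_neg {n : ℕ} {M : Type*} [AddCommMonoid M] (F : (Fin n → ℝ) → M) :
    ∑ e : Fin n → Bool, F (fun i => -boolSign (e i)) =
      ∑ e : Fin n → Bool, F (fun i => boolSign (e i)) := by
  rw [← (Equiv.piCongrRight fun _ : Fin n => Equiv.boolNot).sum_comp
    fun e : Fin n → Bool => F (fun i => boolSign (e i))]
  simp [boolSign_not]

lemma sum_signs_ciSup_neg {ι : Type*} {n : ℕ} (a : ι → Fin n → ℝ) :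
    ∑ e : Fin n → Bool, ⨆ k, ∑ i, boolSign (e i) * -a k i =
      ∑ e : Fin n → Bool, ⨆ k, ∑ i, boolSign (e i) * a k i := by
  rw [← sum_signs_neg fun e => ⨆ k, ∑ i, e i * a k i]
  simp

section FiniteFamily

variable {X : Type*} [MeasurableSpace X]

/-- Introducing signs: exchanging the two points of each pair on which the sign is `-1` preserves
the law of `n` independent pairs. -/
lemma integral_ciSup_sign_mul_sub {ι : Type*} (μ : Measure X) [IsProbabilityMeasure μ] (n : ℕ)
    (g : ι → X → ℝ) (e : Fin n → Bool) :
    ∫ Z : Fin n → X × X, (⨆ k, ∑ i, boolSign (e i) * (g k (Z i).2 - g k (Z i).1))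
        ∂(Measure.pi fun _ => μ.prod μ) =
      ∫ Z : Fin n → X × X, (⨆ k, ∑ i, (g k (Z i).2 - g k (Z i).1))
        ∂(Measure.pi fun _ => μ.prod μ) := by
  let σ : Fin n → (X × X ≃ᵐ X × X) := fun i =>
    if e i then MeasurableEquiv.refl _ else MeasurableEquiv.prodComm
  have hσ : ∀ i, MeasurePreserving (σ i) (μ.prod μ) (μ.prod μ) := fun i => by
    by_cases h : e i
    · simp only [σ, h, if_true]
      exact MeasurePreserving.id _
    · simp only [σ, h]
      exact Measure.measurePreserving_swap
  have hpi := measurePreserving_pi (fun _ : Fin n => μ.prod μ) (fun _ => μ.prod μ) hσ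
  have hemb : MeasurableEmbedding fun (Z : Fin n → X × X) i => σ i (Z i) :=
    (MeasurableEquiv.piCongrRight σ).measurableEmbedding
  rw [← hpi.integral_comp hemb]
  refine integral_congr_ae (Filter.Eventually.of_forall fun Z => ?_)
  refine iSup_congr fun k => Finset.sum_congr rfl fun i _ => ?_
  by_cases h : e i
  · simp [σ, h]
  · simp [σ, h, MeasurableEquiv.prodComm]

/-- Symmetrization: the expected largest deviation over a finite family is at most twice its
Rademacher complexity. -/
lemma integral_ciSup_deviation_le {ι : Type*} [Finite ι] [Nonempty ι] (μ : Measure X)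
    [IsProbabilityMeasure μ] (n : ℕ) (g : ι → X → ℝ) (hg : ∀ k, Measurable (g k)) {c D : ℝ}
    (hc : ∀ k x, |g k x| ≤ c) {p : X → Prop} (hp : ∀ᵐ x ∂μ, p x)
    (hD : ∀ S : Fin n → X, (∀ i, p (S i)) →
      ∑ e : Fin n → Bool, (⨆ k, ∑ i, boolSign (e i) * g k (S i)) ≤ 2 ^ n * D) :
    ∫ S : Fin n → X, (⨆ k, (n * ∫ x, g k x ∂μ - ∑ i, g k (S i))) ∂(Measure.pi fun _ => μ) ≤
      2 * D := by
  set P := Measure.pi fun _ : Fin n => μ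
  set Q := Measure.pi fun _ : Fin n => μ.prod μ
  have hgi : ∀ k (i : Fin n), Integrable (fun S : Fin n → X => g k (S i)) P := fun k i =>
    Integrable.of_bound ((hg k).comp (measurable_pi_apply i)).aestronglyMeasurable c
      (Filter.Eventually.of_forall fun S => hc k _)
  have hgmean : ∀ k (i : Fin n), ∫ S : Fin n → X, g k (S i) ∂P = ∫ x, g k x ∂μ := fun k i =>
    integral_comp_eval (μ := fun _ : Fin n => μ) (hg k).aestronglyMeasurable
  have hsub : ∀ k x y, |g k y - g k x| ≤ 2 * c := fun k x y => by
    have := abs_sub (g k y) (g k x)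
    linarith [hc k x, hc k y]
  have hmeas : Measurable fun q : (Fin n → X) × (Fin n → X) =>
      ⨆ k, ∑ i, (g k (q.2 i) - g k (q.1 i)) := by
    refine Measurable.iSup fun k => Finset.measurable_sum _ fun i _ => ?_
    exact ((hg k).comp ((measurable_pi_apply i).comp measurable_snd)).sub
      ((hg k).comp ((measurable_pi_apply i).comp measurable_fst))
  have hint : Integrable (fun q : (Fin n → X) × (Fin n → X) =>
      ⨆ k, ∑ i, (g k (q.2 i) - g k (q.1 i))) (P.prod P) :=
    Integrable.of_bound hmeas.aestronglyMeasurable (n * (2 * c))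
      (Filter.Eventually.of_forall fun q => abs_ciSup_le fun k => abs_sum_fin_le fun i =>
        hsub k _ _)
  have hintF : Integrable (fun S : Fin n → X =>
      ⨆ k, (n * ∫ x, g k x ∂μ - ∑ i, g k (S i))) P := by
    refine Integrable.of_bound (C := n * (2 * c)) (Measurable.iSup fun k => measurable_const.sub
      (Finset.measurable_sum _ fun i _ =>
        (hg k).comp (measurable_pi_apply i))).aestronglyMeasurable
      (Filter.Eventually.of_forall fun S => abs_ciSup_le fun k => ?_)
    have h1 : |∫ x, g k x ∂μ| ≤ c := by
      simpa using norm_integral_le_of_norm_le_const (μ := μ) (f := g k) (C := c)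
        (Filter.Eventually.of_forall fun x => hc k x)
    have h2 : n * ∫ x, g k x ∂μ - ∑ i, g k (S i) = ∑ i, (∫ x, g k x ∂μ - g k (S i)) := by
      simp
    rw [h2]
    refine abs_sum_fin_le fun i => (abs_sub _ _).trans ?_
    linarith [hc k (S i)]
  have hsign (e : Fin n → Bool) : Integrable (fun Z : Fin n → X × X =>
      ⨆ k, ∑ i, boolSign (e i) * (g k (Z i).2 - g k (Z i).1)) Q := by
    refine Integrable.of_bound (C := n * (2 * c))
      (Measurable.iSup fun k => Finset.measurable_sum _ fun i _ => (Measurable.const_mul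
        (((hg k).comp (measurable_snd.comp (measurable_pi_apply i))).sub
          ((hg k).comp (measurable_fst.comp (measurable_pi_apply i)))) _)).aestronglyMeasurable
      (Filter.Eventually.of_forall fun Z => abs_ciSup_le fun k => abs_sum_fin_le fun i => ?_)
    rw [abs_mul]
    cases e i <;> simpa using hsub k _ _
  have hpZ : ∀ᵐ Z ∂Q, ∀ i, p (Z i).1 ∧ p (Z i).2 := by
    refine ae_all_iff.2 fun i => ?_
    have h1 : ∀ᵐ z ∂(μ.prod μ), p z.1 ∧ p z.2 :=
      (Measure.quasiMeasurePreserving_fst.ae hp).and (Measure.quasiMeasurePreserving_snd.ae hp)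
    exact (Measure.quasiMeasurePreserving_eval (fun _ : Fin n => μ.prod μ) i).ae h1
  -- the mean is the average over an independent ghost sample; pull it out of the supremum
  have hghost : ∫ S : Fin n → X, (⨆ k, (n * ∫ x, g k x ∂μ - ∑ i, g k (S i))) ∂P ≤
      ∫ Z : Fin n → X × X, (⨆ k, ∑ i, (g k (Z i).2 - g k (Z i).1)) ∂Q := by
    have hmp := measurePreserving_arrowProdEquivProdArrow X X (Fin n) (fun _ => μ) (fun _ => μ)
    calc _ ≤ ∫ S, ∫ S', (⨆ k, ∑ i, (g k (S' i) - g k (S i))) ∂P ∂P := by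
          refine integral_mono hintF hint.integral_prod_left fun S => ciSup_le fun k => ?_
          have h1 : n * ∫ x, g k x ∂μ - ∑ i, g k (S i) =
              ∫ S', ∑ i, (g k (S' i) - g k (S i)) ∂P := by
            rw [integral_finsetSum (f := fun i (S' : Fin n → X) => g k (S' i) - g k (S i)) _
              fun i _ => (hgi k i).sub (integrable_const _)]
            simp [integral_sub (hgi k _) (integrable_const _), hgmean]
          rw [h1]
          refine integral_mono (integrable_finsetSum _ fun i _ =>
            (hgi k i).sub (integrable_const _)) ?_ fun S' =>
              le_ciSup (f := fun k => ∑ i, (g k (S' i) - g k (S i)))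
                (Set.finite_range _).bddAbove k
          exact Integrable.of_bound (hmeas.comp
            (measurable_const.prodMk measurable_id)).aestronglyMeasurable (n * (2 * c))
            (Filter.Eventually.of_forall fun S' => abs_ciSup_le fun k => abs_sum_fin_le fun i =>
              hsub k _ _)
      _ = _ := by
          rw [← integral_prod _ hint, ← hmp.integral_comp']
          rfl
  have hbound : ∀ Z : Fin n → X × X, (∀ i, p (Z i).1 ∧ p (Z i).2) →
      ∑ e : Fin n → Bool, (⨆ k, ∑ i, boolSign (e i) * (g k (Z i).2 - g k (Z i).1)) ≤
        2 ^ n * (2 * D) := fun Z hZ => by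
    calc _ ≤ ∑ e : Fin n → Bool, ((⨆ k, ∑ i, boolSign (e i) * g k (Z i).2) +
          ⨆ k, ∑ i, boolSign (e i) * -g k (Z i).1) := by
          refine Finset.sum_le_sum fun e _ => ?_
          simp only [sub_eq_add_neg, mul_add, Finset.sum_add_distrib]
          exact ciSup_add_le_ciSup_add_ciSup _ _
      _ ≤ 2 ^ n * D + 2 ^ n * D := by
          rw [Finset.sum_add_distrib, sum_signs_ciSup_neg fun k i => g k (Z i).1]
          exact add_le_add (hD _ fun i => (hZ i).2) (hD _ fun i => (hZ i).1)
      _ = _ := by ring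
  refine hghost.trans (le_of_mul_le_mul_left ?_ (by positivity : (0 : ℝ) < 2 ^ n))
  calc _ = ∑ e : Fin n → Bool,
        ∫ Z : Fin n → X × X, (⨆ k, ∑ i, boolSign (e i) * (g k (Z i).2 - g k (Z i).1)) ∂Q := by
        simp [integral_ciSup_sign_mul_sub, Q]
    _ = ∫ Z : Fin n → X × X,
        ∑ e : Fin n → Bool, (⨆ k, ∑ i, boolSign (e i) * (g k (Z i).2 - g k (Z i).1)) ∂Q :=
        (integral_finsetSum _ fun e _ => hsign e).symm
    _ ≤ ∫ _Z, 2 ^ n * (2 * D) ∂Q :=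
        integral_mono_ae (integrable_finsetSum _ fun e _ => hsign e) (integrable_const _)
          (hpZ.mono hbound)
    _ = _ := by simp

/-! ### Uniform deviation bounds -/

/-- With probability at least `1 - δ / 2`, all one-sided deviations over a finite family are
controlled by twice the Rademacher complexity and a concentration term. -/
lemma measure_exists_deviation_ge_le {ι : Type*} [Finite ι] [Nonempty ι] (μ : Measure X)
    [IsProbabilityMeasure μ] {n : ℕ} (hn : 0 < n) (g : ι → X → ℝ) (hg : ∀ k, Measurable (g k))
    {c D δ : ℝ} (hc₀ : 0 < c) (hδ₀ : 0 < δ) (hδ₁ : δ < 1) (hc : ∀ k x, |g k x| ≤ c)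
    {p : X → Prop} (hp : ∀ᵐ x ∂μ, p x)
    (hD : ∀ S : Fin n → X, (∀ i, p (S i)) →
      ∑ e : Fin n → Bool, (⨆ k, ∑ i, boolSign (e i) * g k (S i)) ≤ 2 ^ n * (n * D)) :
    (Measure.pi fun _ : Fin n => μ).real
        {S | ∃ k, 2 * D + 2 * c * √(Real.log (2 / δ) / (2 * n)) ≤
          ∫ x, g k x ∂μ - 1 / (n : ℝ) * ∑ i, g k (S i)} ≤ δ / 2 := by
  have hn' : (0 : ℝ) < n := by exact_mod_cast hn
  have hL : 0 ≤ Real.log (2 / δ) := Real.log_nonneg (by rw [le_div_iff₀ hδ₀]; linarith)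
  set L := Real.log (2 / δ) with hLdef
  set f : (Fin n → X) → ℝ := fun S => ⨆ k, (n * ∫ x, g k x ∂μ - ∑ i, g k (S i))
  have hf : Measurable f := Measurable.iSup fun k => measurable_const.sub
    (Finset.measurable_sum _ fun i _ => (hg k).comp (measurable_pi_apply i))
  have hfC : ∀ S, |f S| ≤ n * c + n * c := fun S => abs_ciSup_le fun k => by
    have h1 : |∫ x, g k x ∂μ| ≤ c := by
      simpa using norm_integral_le_of_norm_le_const (μ := μ) (f := g k) (C := c)
        (Filter.Eventually.of_forall fun x => hc k x)
    refine (abs_sub _ _).trans (add_le_add ?_ (abs_sum_fin_le fun i => hc k _))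
    rw [abs_mul, abs_of_pos hn']
    gcongr
  -- changing one sample point moves the supremum by at most `2 c`
  have hstep : ∀ S i x, f (Function.update S i x) - f S ≤ 2 * c ∧
      f S - f (Function.update S i x) ≤ 2 * c := fun S i x => by
    have hdiff : ∀ k, |∑ j, g k (Function.update S i x j) - ∑ j, g k (S j)| ≤ 2 * c := fun k => by
      have h1 : ∑ j, g k (Function.update S i x j) - ∑ j, g k (S j) = g k x - g k (S i) := by
        rw [← Finset.sum_sub_distrib, Finset.sum_eq_single i]
        · simp
        · intro j _ hj
          simp [Function.update_of_ne hj]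
        · simp
      rw [h1]
      refine (abs_sub _ _).trans ?_
      linarith [hc k x, hc k (S i)]
    constructor
    · rw [sub_le_iff_le_add']
      refine ciSup_le fun k => ?_
      have h2 : _ ≤ f S := le_ciSup (f := fun k => n * ∫ x, g k x ∂μ - ∑ i, g k (S i))
        (Set.finite_range _).bddAbove k
      linarith [(abs_le.1 (hdiff k)).1]
    · rw [sub_le_iff_le_add']
      refine ciSup_le fun k => ?_
      have h2 : _ ≤ f (Function.update S i x) :=
        le_ciSup (f := fun k => n * ∫ x, g k x ∂μ - ∑ j, g k (Function.update S i x j))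
          (Set.finite_range _).bddAbove k
      linarith [(abs_le.1 (hdiff k)).2]
  have hmean := integral_ciSup_deviation_le μ n g hg hc hp hD
  have htail := measure_add_integral_le_of_boundedDiff μ n f hf hfC
    (fun S i x => abs_le.2 ⟨by linarith [(hstep S i x).2], (hstep S i x).1⟩)
    (ε := n * (2 * c * √(L / (2 * n)))) (by positivity)
  -- the deviation is chosen such that the exponent of the tail bound is `-L`
  have hexponent : -2 * (n * (2 * c * √(L / (2 * n)))) ^ 2 / (n * (2 * c) ^ 2) = -L := by
    rw [mul_pow, mul_pow, Real.sq_sqrt (by positivity)]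
    field_simp
  rw [hexponent, Real.exp_neg, hLdef, Real.exp_log (by positivity), inv_div] at htail
  refine le_trans (measureReal_mono ?_) htail
  rintro S ⟨k, hk⟩
  have h2 : _ ≤ f S := le_ciSup (f := fun k => n * ∫ x, g k x ∂μ - ∑ i, g k (S i))
    (Set.finite_range _).bddAbove k
  have h3 := mul_le_mul_of_nonneg_left hk hn'.le
  have h4 : n * (∫ x, g k x ∂μ - 1 / (n : ℝ) * ∑ i, g k (S i)) =
      n * ∫ x, g k x ∂μ - ∑ i, g k (S i) := by
    field_simp
  change _ ≤ f S
  rw [h4] at h3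
  change ∫ S, f S ∂_ ≤ _ at hmean
  linarith

lemma measurableSet_forall_abs_deviation_le {ι : Type*} [Countable ι] (μ : Measure X) (n : ℕ)
    (g : ι → X → ℝ) (hg : ∀ k, Measurable (g k)) (b : ℝ) :
    MeasurableSet {S : Fin n → X |
      ∀ k, |∫ x, g k x ∂μ - 1 / (n : ℝ) * ∑ i, g k (S i)| ≤ b} := by
  simp only [Set.ofPred_forall]
  exact MeasurableSet.iInter fun k => measurableSet_le (measurable_const.sub
    (Measurable.const_mul (Finset.measurable_sum _
      fun i _ => (hg k).comp (measurable_pi_apply i)) _)).abs measurable_const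

/-- The two-sided uniform deviation bound for a finite family `g`, in terms of a bound `D` on its
normalized empirical Rademacher complexity. -/
lemma le_measure_forall_abs_deviation_le {ι : Type*} [Finite ι] [Nonempty ι] (μ : Measure X)
    [IsProbabilityMeasure μ] {n : ℕ} (hn : 0 < n) (g : ι → X → ℝ) (hg : ∀ k, Measurable (g k))
    {c D δ : ℝ} (hc₀ : 0 < c) (hδ₀ : 0 < δ) (hδ₁ : δ < 1) (hc : ∀ k x, |g k x| ≤ c)
    {p : X → Prop} (hp : ∀ᵐ x ∂μ, p x)
    (hD : ∀ S : Fin n → X, (∀ i, p (S i)) →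
      ∑ e : Fin n → Bool, (⨆ k, ∑ i, boolSign (e i) * g k (S i)) ≤ 2 ^ n * (n * D)) :
    1 - δ ≤ (Measure.pi fun _ : Fin n => μ).real
        {S | ∀ k, |∫ x, g k x ∂μ - 1 / (n : ℝ) * ∑ i, g k (S i)| ≤
          2 * D + 2 * c * √(Real.log (2 / δ) / (2 * n))} := by
  set E := {S : Fin n → X | ∀ k, |∫ x, g k x ∂μ - 1 / (n : ℝ) * ∑ i, g k (S i)| ≤
          2 * D + 2 * c * √(Real.log (2 / δ) / (2 * n))}
  have hE : MeasurableSet E := measurableSet_forall_abs_deviation_le μ n g hg _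
  have h1 := measure_exists_deviation_ge_le μ hn g hg hc₀ hδ₀ hδ₁ hc hp hD
  have h2 := measure_exists_deviation_ge_le μ hn (fun k x => -g k x) (fun k => (hg k).neg)
    hc₀ hδ₀ hδ₁ (fun k x => by rw [abs_neg]; exact hc k x) hp (D := D) fun S hS => by
      rw [sum_signs_ciSup_neg fun k i => g k (S i)]
      exact hD S hS
  have h3 : (Measure.pi fun _ : Fin n => μ).real Eᶜ ≤ δ / 2 + δ / 2 := by
    refine le_trans (measureReal_mono ?_) ((measureReal_union_le _ _).trans (add_le_add h1 h2))
    intro S hS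
    simp only [E, Set.mem_compl_iff, Set.mem_ofPred_eq, not_forall, not_le] at hS
    obtain ⟨k, hk⟩ := hS
    rcases lt_abs.1 hk with h | h
    · exact Or.inl ⟨k, h.le⟩
    · refine Or.inr ⟨k, ?_⟩
      simp only [integral_neg, Finset.sum_neg_distrib]
      linarith
  rw [probReal_compl_eq_one_sub hE] at h3
  linarith

end FiniteFamily

/-! ### Generalization bounds for linear predictors -/

/-- A uniform bound over every finite subfamily of a ball passes to the whole ball: exhaust a
countable dense subset, then use that the deviation is continuous in `θ`. -/
lemma le_measure_forall_mem_closedBall {X H : Type*} [MeasurableSpace X] [NormedAddCommGroup H]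
    [TopologicalSpace.SeparableSpace H] (μ : Measure X) [IsProbabilityMeasure μ] (n : ℕ)
    (g : H → X → ℝ) (hg : ∀ θ, Measurable (g θ)) (hcont : ∀ x, Continuous fun θ => g θ x)
    {c : ℝ} (hc : ∀ θ x, |g θ x| ≤ c) {R b a : ℝ} (hR : 0 ≤ R)
    (hfin : ∀ (N : ℕ) (θ : Fin (N + 1) → H), (∀ k, ‖θ k‖ ≤ R) →
      a ≤ (Measure.pi fun _ : Fin n => μ).real
        {S | ∀ k, |∫ x, g (θ k) x ∂μ - 1 / (n : ℝ) * ∑ i, g (θ k) (S i)| ≤ b}) :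
    a ≤ (Measure.pi fun _ : Fin n => μ).real
      {S | ∀ θ, ‖θ‖ ≤ R → |∫ x, g θ x ∂μ - 1 / (n : ℝ) * ∑ i, g θ (S i)| ≤ b} := by
  set P := Measure.pi fun _ : Fin n => μ
  have : SecondCountableTopology H := UniformSpace.secondCountable_of_separable H
  have : Nonempty (Metric.closedBall (0 : H) R) := ⟨⟨0, by simpa using hR⟩⟩
  set u := TopologicalSpace.denseSeq (Metric.closedBall (0 : H) R)
  have hu : DenseRange u := TopologicalSpace.denseRange_denseSeq _
  have hnorm : ∀ k, ‖(u k : H)‖ ≤ R := fun k => mem_closedBall_zero_iff.1 (u k).2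
  set E : ℕ → Set (Fin n → X) := fun N => {S | ∀ k : Fin (N + 1),
    |∫ x, g (u k) x ∂μ - 1 / (n : ℝ) * ∑ i, g (u k) (S i)| ≤ b}
  have hE : ∀ N, MeasurableSet (E N) := fun N =>
    measurableSet_forall_abs_deviation_le μ n (fun k : Fin (N + 1) => g (u k)) (fun k => hg _) b
  have hanti : Antitone E := fun N N' hN S hS k => hS (Fin.castLE (by omega) k)
  have hlim := tendsto_measure_iInter_atTop (μ := P) (fun N => (hE N).nullMeasurableSet) hanti
    ⟨0, measure_ne_top _ _⟩
  have hInter : a ≤ P.real (⋂ N, E N) :=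
    ge_of_tendsto' ((ENNReal.tendsto_toReal (measure_ne_top _ _)).comp hlim)
      fun N => hfin N (fun k => u k) fun k => hnorm k
  refine hInter.trans (measureReal_mono ?_)
  intro S hS θ hθ
  have hint : Continuous fun θ => ∫ x, g θ x ∂μ :=
    continuous_of_dominated (bound := fun _ => c) (fun θ => (hg θ).aestronglyMeasurable)
      (fun θ => Filter.Eventually.of_forall fun x => hc θ x) (integrable_const _)
      (Filter.Eventually.of_forall hcont)
  have hdev : Continuous fun θ : Metric.closedBall (0 : H) R =>
      |∫ x, g θ x ∂μ - 1 / (n : ℝ) * ∑ i, g θ (S i)| :=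
    ((hint.sub (continuous_const.mul
      (continuous_finsetSum _ fun i _ => hcont _))).abs).comp continuous_subtype_val
  have hclosed := isClosed_le hdev (continuous_const (y := b))
  refine hu.induction_on (p := fun θ : Metric.closedBall (0 : H) R =>
    |∫ x, g θ x ∂μ - 1 / (n : ℝ) * ∑ i, g θ (S i)| ≤ b)
    ⟨θ, mem_closedBall_zero_iff.2 hθ⟩ hclosed fun k => ?_
  exact Set.mem_iInter.1 hS k (Fin.last k)

/-- Generalization bound for norm-bounded linear predictors in a Hilbert space under a bounded
Lipschitz loss. -/
lemma le_measure_forall_linear_predictor {X H : Type*} [MeasurableSpace X]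
    [NormedAddCommGroup H] [InnerProductSpace ℝ H] [TopologicalSpace.SeparableSpace H]
    [MeasurableSpace H] [BorelSpace H] (μ : Measure X) [IsProbabilityMeasure μ] {n : ℕ}
    (hn : 0 < n) (φ : X → H) (hφ : Measurable φ) (ζ : X → ℝ) (hζ : Measurable ζ)
    {loss : ℝ → ℝ → ℝ} {ℓ c δ R r : ℝ} (hδ₀ : 0 < δ) (hδ₁ : δ < 1) (hR : 0 ≤ R) (hr : 0 ≤ r)
    (hφr : ∀ᵐ x ∂μ, ‖φ x‖ ≤ r) (hmeas : Measurable (Function.uncurry loss))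
    (hc : ∀ y z, |loss y z| ≤ c) (hℓ : ∀ y y' z, |loss y z - loss y' z| ≤ ℓ * |y - y'|) :
    1 - δ ≤ (Measure.pi fun _ : Fin n => μ).real
      {S | ∀ θ, ‖θ‖ ≤ R → |∫ x, loss (inner ℝ θ (φ x)) (ζ x) ∂μ -
        1 / (n : ℝ) * ∑ i, loss (inner ℝ θ (φ (S i))) (ζ (S i))| ≤
          2 * (ℓ * R * r / √n) + 2 * c * √(Real.log (2 / δ) / (2 * n))} := by
  have hn' : (0 : ℝ) < n := by exact_mod_cast hn
  have hℓ₀ : 0 ≤ ℓ := by simpa using (abs_nonneg _).trans (hℓ 1 0 0)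
  rcases ((abs_nonneg _).trans (hc 0 0)).eq_or_lt with hc₀ | hc₀
  -- for `c = 0` the tail bound degenerates, but then the loss vanishes
  · have hzero : ∀ y z, loss y z = 0 := fun y z => abs_nonpos_iff.1 (hc₀ ▸ hc y z)
    have : ∀ S : Fin n → X, S ∈ {S : Fin n → X | ∀ θ, ‖θ‖ ≤ R →
        |∫ x, loss (inner ℝ θ (φ x)) (ζ x) ∂μ -
        1 / (n : ℝ) * ∑ i, loss (inner ℝ θ (φ (S i))) (ζ (S i))| ≤
          2 * (ℓ * R * r / √n) + 2 * c * √(Real.log (2 / δ) / (2 * n))} := fun S θ _ => by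
      simp only [hzero, ← hc₀]
      simp only [integral_zero, Finset.sum_const_zero, mul_zero, sub_zero, abs_zero, zero_mul,
        add_zero]
      positivity
    rw [Set.eq_univ_of_forall this]
    simpa using hδ₀.le
  have : SecondCountableTopology H := UniformSpace.secondCountable_of_separable H
  have hlip : ∀ z, Continuous fun y => loss y z := fun z =>
    (LipschitzWith.of_dist_le_mul (K := ℓ.toNNReal) fun y y' => by
      simpa [Real.dist_eq, Real.coe_toNNReal _ hℓ₀] using hℓ y y' z).continuous
  have hg : ∀ θ : H, Measurable fun x => loss (inner ℝ θ (φ x)) (ζ x) := fun θ =>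
    hmeas.comp ((measurable_const.inner hφ).prodMk hζ)
  refine le_measure_forall_mem_closedBall μ n (fun θ x => loss (inner ℝ θ (φ x)) (ζ x)) hg
    (fun x => (hlip _).comp (continuous_id.inner continuous_const)) (fun θ x => hc _ _) hR
    fun N θ hθ => ?_
  refine le_measure_forall_abs_deviation_le μ hn (fun k x => loss (inner ℝ (θ k) (φ x)) (ζ x))
    (fun k => hg _) hc₀ hδ₀ hδ₁ (fun k x => hc _ _) hφr fun S hS => ?_
  have hrad := sum_signs_ciSup_le_of_linear n θ (fun i => φ (S i))
    (fun k i => loss (inner ℝ (θ k) (φ (S i))) (ζ (S i))) hℓ₀ hR hr hθ hS fun i k l => hℓ _ _ _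
  refine hrad.trans_eq ?_
  have : (√n : ℝ) * √n = n := Real.mul_self_sqrt hn'.le
  have h0 : (√n : ℝ) ≠ 0 := (Real.sqrt_pos.2 hn').ne'
  field_simp
  rw [sq, this]

/-! ### Linear attention as a linear predictor -/

lemma outputMatrix_mulVec_inputMatrix_mulVec {N d : ℕ} (WB WC : Matrix (Fin N) (Fin d) ℝ)
    (v v' : EuclideanSpace ℝ (Fin d)) (j : Fin d) :
    (outputMatrix WC v *ᵥ (inputMatrix WB v' *ᵥ v'.ofLp)) j =
      v' j * ∑ n, (WC *ᵥ v.ofLp) n * (WB *ᵥ v'.ofLp) n := by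
  have h1 : ∀ i n, (inputMatrix WB v' *ᵥ v'.ofLp) (i, n) = (WB *ᵥ v'.ofLp) n * v' i := by
    intro i n
    rw [Matrix.mulVec, dotProduct]
    simp [inputMatrix, Matrix.kroneckerMap_apply, Matrix.one_apply]
  rw [Matrix.mulVec, dotProduct, Fintype.sum_prod_type]
  simp only [h1]
  simp [outputMatrix, Matrix.kroneckerMap_apply, Matrix.one_apply, Matrix.vecMul_transpose,
    Finset.mul_sum]
  refine Finset.sum_congr rfl fun n _ => by ring

/-- The feature `∑ₛ u[s] ⊗ u[T] ⊗ u[s]`, `s < T`, of an input signal; linear attention is linear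
in it. The sum runs over `s = T - 1 - t`, as in `linearAttention`. -/
def attentionFeature {d : ℕ} (T : ℕ) (u : Signal d) :
    EuclideanSpace ℝ (Fin d × Fin d × Fin d) :=
  ∑ t ∈ Finset.range T, WithLp.toLp 2 fun p =>
    u (T - 1 - t) p.1 * (u T p.2.1 * u (T - 1 - t) p.2.2)

/-- The coefficient tensor `w ⊗ W_Cᵀ W_B` of linear attention. -/
def attentionTensor {N d : ℕ} (WB WC : Matrix (Fin N) (Fin d) ℝ)
    (w : EuclideanSpace ℝ (Fin d)) : EuclideanSpace ℝ (Fin d × Fin d × Fin d) :=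
  WithLp.toLp 2 fun p => w p.1 * ∑ n, WC n p.2.1 * WB n p.2.2

lemma linearAttention_eq_inner {N d : ℕ} (WB WC : Matrix (Fin N) (Fin d) ℝ)
    (w : EuclideanSpace ℝ (Fin d)) (T : ℕ) (u : Signal d) :
    linearAttention WB WC w T u = inner ℝ (attentionTensor WB WC w) (attentionFeature T u) := by
  have h (v v' : EuclideanSpace ℝ (Fin d)) :
      ∑ n, (WC *ᵥ v.ofLp) n * (WB *ᵥ v'.ofLp) n =
        ∑ a, ∑ b, (v a * v' b) * ∑ n, WC n a * WB n b := by
    simp only [Matrix.mulVec, dotProduct, Finset.sum_mul_sum]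
    simp only [Finset.mul_sum]
    rw [Finset.sum_comm]
    refine Finset.sum_congr rfl fun a _ => ?_
    rw [Finset.sum_comm]
    exact Finset.sum_congr rfl fun b _ => Finset.sum_congr rfl fun n _ => by ring
  rw [linearAttention, dotProduct_sum, attentionFeature, inner_sum]
  refine Finset.sum_congr rfl fun t _ => ?_
  simp only [dotProduct, outputMatrix_mulVec_inputMatrix_mulVec, h, PiLp.inner_apply,
    attentionTensor, Fintype.sum_prod_type, Finset.mul_sum]
  refine Finset.sum_congr rfl fun j _ => Finset.sum_congr rfl fun a _ =>
    Finset.sum_congr rfl fun b _ => ?_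
  simp only [RCLike.inner_apply, conj_trivial, Finset.mul_sum]
  exact Finset.sum_congr rfl fun n _ => by ring

lemma norm_toLp_tensor {α β γ : Type*} [Fintype α] [Fintype β] [Fintype γ]
    (x : EuclideanSpace ℝ α) (y : EuclideanSpace ℝ β) (z : EuclideanSpace ℝ γ) :
    ‖(WithLp.toLp 2 fun p => x p.1 * (y p.2.1 * z p.2.2) : EuclideanSpace ℝ (α × β × γ))‖ =
      ‖x‖ * (‖y‖ * ‖z‖) := by
  rw [← sq_eq_sq₀ (norm_nonneg _) (by positivity), mul_pow, mul_pow]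
  simp only [EuclideanSpace.real_norm_sq_eq, Fintype.sum_prod_type, mul_pow, ← Finset.mul_sum,
    ← Finset.sum_mul]

lemma norm_attentionFeature_le {d : ℕ} (T : ℕ) (u : Signal d) {b : ℝ} (hu : ∀ t, ‖u t‖ ≤ b) :
    ‖attentionFeature T u‖ ≤ T * b ^ 3 := by
  have hb : 0 ≤ b := (norm_nonneg _).trans (hu 0)
  refine (norm_sum_le _ _).trans ((Finset.sum_le_card_nsmul _ _ (b ^ 3) fun t _ => ?_).trans_eq
    (by simp))
  rw [norm_toLp_tensor]
  calc _ ≤ b * (b * b) := by gcongr <;> exact hu _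
    _ = b ^ 3 := by ring

lemma euclideanSpace_norm_le_sum_abs {α : Type*} [Fintype α] (x : EuclideanSpace ℝ α) :
    ‖x‖ ≤ ∑ i, |x i| := by
  classical
  calc ‖x‖ = ‖∑ i, EuclideanSpace.single i (x i)‖ := by
        congr 1
        ext i
        simp
    _ ≤ ∑ i, ‖EuclideanSpace.single i (x i)‖ := norm_sum_le _ _
    _ = _ := by simp

/-- The Euclidean norm of the coefficient tensor is at most its `ℓ¹` norm, which is
submultiplicative. -/
lemma norm_attentionTensor_le {N d : ℕ} (WB WC : Matrix (Fin N) (Fin d) ℝ)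
    (w : EuclideanSpace ℝ (Fin d)) :
    ‖attentionTensor WB WC w‖ ≤ (∑ j, |w j|) * (norm11 WC * norm11 WB) := by
  have h : ∑ a, ∑ b, |∑ n, WC n a * WB n b| ≤ norm11 WC * norm11 WB := by
    calc _ ≤ ∑ a, ∑ b, ∑ n, |WC n a| * |WB n b| := by
          refine Finset.sum_le_sum fun a _ => Finset.sum_le_sum fun b _ => ?_
          simpa only [abs_mul] using Finset.abs_sum_le_sum_abs (fun n => WC n a * WB n b) _
      _ ≤ ∑ a, ∑ b, (∑ n, |WC n a|) * ∑ n, |WB n b| := by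
          refine Finset.sum_le_sum fun a _ => Finset.sum_le_sum fun b _ => ?_
          rw [Finset.mul_sum]
          refine Finset.sum_le_sum fun n _ => mul_le_mul_of_nonneg_right ?_ (abs_nonneg _)
          exact Finset.single_le_sum (f := fun n => |WC n a|) (fun n _ => abs_nonneg _)
            (Finset.mem_univ n)
      _ = _ := by rw [norm11, norm11, Finset.sum_mul_sum]
  refine (euclideanSpace_norm_le_sum_abs _).trans ?_
  simp only [attentionTensor, Fintype.sum_prod_type, abs_mul, ← Finset.mul_sum, ← Finset.sum_mul]
  exact mul_le_mul_of_nonneg_left h (Finset.sum_nonneg fun j _ => abs_nonneg _)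

lemma measurable_attentionFeature {d : ℕ} (T : ℕ) :
    Measurable (attentionFeature T : Signal d → _) := by
  unfold attentionFeature
  fun_prop

/-! ### The reduction of selective SSMs to linear attention -/

lemma stepSize_log_exp_one_sub_one {d : ℕ} (u : Signal d) (t : ℕ) :
    stepSize (Real.log (Real.exp 1 - 1)) 0 u t = 1 := by
  have h : 0 < Real.exp 1 - 1 := by linarith [Real.add_one_lt_exp (one_ne_zero)]
  simp [stepSize, softplus, Real.exp_log h]

lemma state_zero_eq_sum {N d : ℕ} (WB : Matrix (Fin N) (Fin d) ℝ) (u : Signal d) (T : ℕ) :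
    state 0 WB (Real.log (Real.exp 1 - 1)) 0 u T =
      ∑ t ∈ Finset.range T, inputMatrix WB (u t) *ᵥ (u t).ofLp := by
  have h0 : stateMatrix (0 : Fin d → Matrix (Fin N) (Fin N) ℝ) = 0 := by
    simp [stateMatrix]
  induction T with
  | zero => rfl
  | succ T ih =>
    rw [state, ih, stepSize_log_exp_one_sub_one, h0, smul_zero, NormedSpace.exp_zero,
      Matrix.one_mulVec, one_smul, Finset.sum_range_succ]

lemma selectiveSSM_zero_eq_linearAttention {N d : ℕ} (WB WC : Matrix (Fin N) (Fin d) ℝ)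
    (w : EuclideanSpace ℝ (Fin d)) (T : ℕ) (u : Signal d) :
    selectiveSSM 0 WB WC (Real.log (Real.exp 1 - 1)) 0 w T u = linearAttention WB WC w T u := by
  rw [selectiveSSM, linearAttention, state_zero_eq_sum, Matrix.mulVec_sum,
    Finset.sum_range_reflect
      (fun t => outputMatrix WC (u T) *ᵥ (inputMatrix WB (u t) *ᵥ (u t).ofLp))]

/-! ### The generalization bound -/

/-- The general bound dominates the one obtained from the linear predictor: the logarithmic
factor is at least `1`, and the constants `2` are below `12` and `3`. -/
lemma le_gapBound {m : ℕ} {ℓ c δ C : ℝ} (hℓ : 0 ≤ ℓ) (hc : 0 ≤ c) (hC : 0 ≤ C) :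
    2 * (ℓ * C / √m) + 2 * c * √(Real.log (2 / δ) / (2 * m)) ≤ gapBound m ℓ c δ C := by
  have h0 : 0 ≤ ℓ * C / √m := by positivity
  have h1 : 0 ≤ max 0 (Real.log (c * √m / (3 * C))) := le_max_left _ _
  have h2 : 0 ≤ c * √(Real.log (2 / δ) / (2 * m)) := by positivity
  have h3 := mul_nonneg h0 h1
  have h4 : gapBound m ℓ c δ C = 12 * (ℓ * C / √m) +
      12 * (ℓ * C / √m * max 0 (Real.log (c * √m / (3 * C)))) +
      3 * (c * √(Real.log (2 / δ) / (2 * m))) := by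
    rw [gapBound]
    ring
  rw [h4]
  linarith

end SSM

theorem mainTheorem2 :
    -- the selective SSM with `A_c = 0`, `q = 0` and constant step size `Δ = 1`
    -- (that is, `p = ln (e - 1)`) is causal linear attention
    (∀ (N d T : ℕ) (WB WC : Matrix (Fin N) (Fin d) ℝ) (w : EuclideanSpace ℝ (Fin d))
        (u : SSM.Signal d),
      (∀ t, SSM.stepSize (Real.log (Real.exp 1 - 1)) 0 u t = 1) ∧
      SSM.selectiveSSM 0 WB WC (Real.log (Real.exp 1 - 1)) 0 w T u
        = SSM.linearAttention WB WC w T u) ∧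
    -- generalization bound, with capacity `K (1 + ln (N d)) ^ k * (T B_w B_B B_C B_u ^ 3)`
    ∃ (K : ℝ) (k : ℕ), 0 < K ∧
      ∀ (N d T m : ℕ) (B_u B_B M_B B_C M_C B_w M_w ℓ c δ : ℝ) (loss : ℝ → ℝ → ℝ)
        (μ : MeasureTheory.Measure (SSM.Signal d × ℝ)),
        MeasureTheory.IsProbabilityMeasure μ →
        0 < m → 0 < δ → δ < 1 →
        (∀ᵐ x ∂μ, ∀ t, ‖x.1 t‖ ≤ B_u) →
        M_B = B_B → M_C = B_C → M_w = B_w →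
        Measurable (Function.uncurry loss) →
        (∀ y z, |loss y z| ≤ c) →
        (∀ y y' z, |loss y z - loss y' z| ≤ ℓ * |y - y'|) →
        1 - δ ≤ (MeasureTheory.Measure.pi (fun _ : Fin m => μ)).real
          {S | ∀ h ∈ SSM.linearAttentionClass N d T B_B M_B B_C M_C B_w M_w,
            SSM.generalizationGap loss μ S h ≤
              SSM.gapBound m ℓ c δ
                (K * (1 + Real.log (N * d)) ^ k * (T * B_w * B_B * B_C * B_u ^ 3))} := by
  -- the bound for linear predictors is free of the dimensions, so the logarithmic factor is not
  -- needed: `K = 1` and `k = 0`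
  refine ⟨fun N d T WB WC w u => ⟨SSM.stepSize_log_exp_one_sub_one u,
    SSM.selectiveSSM_zero_eq_linearAttention WB WC w T u⟩, 1, 0, one_pos, ?_⟩
  rintro N d T m B_u _ B_B _ B_C _ B_w ℓ c δ loss μ hμ hm hδ₀ hδ₁ hu rfl rfl rfl hmeas hc hℓ
  obtain ⟨x₀, hx₀⟩ := hu.exists
  have hBu : 0 ≤ B_u := (norm_nonneg _).trans (hx₀ 0)
  have hℓ₀ : 0 ≤ ℓ := by simpa using (abs_nonneg _).trans (hℓ 1 0 0)
  have hc₀ : 0 ≤ c := (abs_nonneg _).trans (hc 0 0)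
  rcases (SSM.linearAttentionClass N d T B_B B_B B_C B_C B_w B_w).eq_empty_or_nonempty with
    hempty | ⟨_, WB₀, WC₀, w₀, hWB₀, -, hWC₀, -, hw₀, -, -⟩
  -- an empty class makes the event everything; otherwise all radii are nonnegative
  · simp only [hempty, Set.mem_empty_iff_false, false_imp_iff, implies_true]
    simpa using hδ₀.le
  have hBB : 0 ≤ B_B := (norm_nonneg _).trans hWB₀
  have hBC : 0 ≤ B_C := (norm_nonneg _).trans hWC₀
  have hBw : 0 ≤ B_w := (norm_nonneg _).trans hw₀
  have hmain := SSM.le_measure_forall_linear_predictor μ hm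
    (fun x => SSM.attentionFeature T x.1)
    ((SSM.measurable_attentionFeature T).comp measurable_fst) Prod.snd measurable_snd hδ₀ hδ₁
    (R := B_w * (B_C * B_B)) (r := T * B_u ^ 3) (by positivity) (by positivity)
    (hu.mono fun x hx => SSM.norm_attentionFeature_le T x.1 hx) hmeas hc hℓ
  refine hmain.trans (MeasureTheory.measureReal_mono ?_)
  rintro S hS _ ⟨WB, WC, w, -, hWB, -, hWC, -, hw, rfl⟩
  have hθ : ‖SSM.attentionTensor WB WC w‖ ≤ B_w * (B_C * B_B) := by
    refine (SSM.norm_attentionTensor_le WB WC w).trans ?_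
    have h1 : 0 ≤ SSM.norm11 WB :=
      Finset.sum_nonneg fun j _ => Finset.sum_nonneg fun i _ => abs_nonneg _
    have h2 : 0 ≤ SSM.norm11 WC :=
      Finset.sum_nonneg fun j _ => Finset.sum_nonneg fun i _ => abs_nonneg _
    gcongr
  have hgap := hS _ hθ
  simp only [← SSM.linearAttention_eq_inner] at hgap
  refine (hgap.trans (le_of_eq ?_)).trans (SSM.le_gapBound hℓ₀ hc₀ (by positivity))
  rw [pow_zero]
  ring
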